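/- For real $c$ let $\Omega_c=\{s\in\mathbb C:\operatorname{Re}s>c\}$. Let $\{w_n\}_{n\ge1}$ be a sequence of positive real numbers and $\sigma_0$ a real number such that $\sum_{n\ge1}w_n^{-1}n^{-2\sigma}<\infty$ for every $\sigma>\sigma_0$, and let $\mathcal H^{\mathbf w}$ be the space of functions $f$ on $\Omega_{\sigma_0}$ of the form $f(s)=\sum_{n\ge1}a_nn^{-s}$ with $\sum_{n\ge1}|a_n|^2w_n<\infty$. Let $\delta\ge0$ and suppose that 1. $w_{mn}=w_mw_n$ for all coprime $m,n\ge1$; 2. $w_{p^k}\le p^{-2\delta}w_{p^{k-1}}$ for every prime $p$ and every integer $k\ge1$. Let $\varphi$ be a bounded holomorphic function on $\Omega_\delta$ which in some right half-plane contained in $\Omega_\delta$ is represented by a convergent Dirichlet series $\sum_{n\ge1}c_nn^{-s}$ (that is, $\varphi\in H^\infty(\Omega_\delta)\cap\mathcal D$). Then $\varphi$ is a multiplier of $\mathcal H^{\mathbf w}$: $\Omega_{\sigma_0}\subseteq\Omega_\delta$, and $\varphi f\in\mathcal H^{\mathbf w}$ for every $f\in\mathcal H^{\mathbf w}$. -/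

import Mathlib

open Filter Topology

namespace DirichletMult

/-- The open half-plane `Ω_δ = {z : Re z > δ}`. -/
def halfPlane (δ : ℝ) : Set ℂ := {z | δ < z.re}

/-- The Dirichlet series `∑_{n ≥ 1} a n * n ^ (-s)` converges, in the ordinary sense of
partial sums (not necessarily absolutely), to `l` at the point `s`.
The value `a 0` plays no role. -/
def DirichletHasSum (a : ℕ → ℂ) (s l : ℂ) : Prop :=
  Tendsto (fun N : ℕ => ∑ n ∈ Finset.Icc 1 N, a n * (n : ℂ) ^ (-s)) atTop (𝓝 l)

/-- The class `𝓓`: a function `φ` with domain `U` belongs to it if `U` contains some open right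
half-plane in which `φ` is represented by a Dirichlet series. -/
def IsDirichletRepresentable (U : Set ℂ) (φ : ℂ → ℂ) : Prop :=
  ∃ c : ℝ, halfPlane c ⊆ U ∧ ∃ a : ℕ → ℂ, ∀ s ∈ halfPlane c, DirichletHasSum a s (φ s)

/-- `φ ∈ H^∞(U)`: bounded and holomorphic on `U`. -/
def IsHInfty (U : Set ℂ) (φ : ℂ → ℂ) : Prop :=
  DifferentiableOn ℂ φ U ∧ ∃ C : ℝ, ∀ s ∈ U, ‖φ s‖ ≤ C

/-- The space `𝓗^w` of functions on `Ω_{σ₀}` given there by a Dirichlet series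
`∑_{n ≥ 1} a n * n ^ (-s)` with `∑_{n ≥ 1} |a n|² w n < ∞`. -/
def weightedSpace (w : ℕ → ℝ) (σ₀ : ℝ) : Set (halfPlane σ₀ → ℂ) :=
  {f | ∃ a : ℕ → ℂ, Summable (fun n : ℕ => ‖a (n + 1)‖ ^ 2 * w (n + 1)) ∧
    ∀ s : halfPlane σ₀, DirichletHasSum a s (f s)}

/-- `φ`, a function with domain `U`, is a multiplier of `𝓗^w`: the domain contains `Ω_{σ₀}`, and
`φ f ∈ 𝓗^w` for every `f ∈ 𝓗^w`. -/
def IsMultiplier (w : ℕ → ℝ) (σ₀ : ℝ) (U : Set ℂ) (φ : ℂ → ℂ) : Prop :=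
  halfPlane σ₀ ⊆ U ∧
    ∀ f ∈ weightedSpace w σ₀, (fun s : halfPlane σ₀ => φ s * f s) ∈ weightedSpace w σ₀

end DirichletMult

open Filter Topology

namespace DirichletMult

/-! Let `|φ| ≤ M`, let `c` be the coefficients of `φ`, and let `b` be the Dirichlet convolution of
`c` and `a`. The mean of `φ(s) (m/n)^s` over a line `Re s = σ > δ` is `c(m/n)`, or `0` if `n ∤ m`.
Parseval's identity and `σ → δ` then bound multiplication by `φ` by `M` for the weight `n^(-2δ)`.
Since `b m` with `m ∣ N` involves only `a n` with `n ∣ N`, the bound holds on each divisor set: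
`∑_{n∣N} |b n|² n^(-2δ) ≤ M² ∑_{n∣N} |a n|² n^(-2δ)` (`sum_norm_sq_convolution_le`).

The hypotheses make `v n = w n * n^(2δ)` multiplicative and decreasing along prime powers. On the
divisors of `D` it is therefore a nonnegative combination of indicators of divisor sets, so the
bounds for all `N ∣ D` combine into `∑_{n∣D} |b n|² w n ≤ M² ∑_{n∣D} |a n|² w n`
(`sum_divisors_weight_mul_nonneg`). As `D` is arbitrary, `b` has finite norm, and the identity
theorem shows that its series is `φ f` (`lSeries_eq_mul`). -/

/-! ### Multiplicative weights on divisor sets -/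

theorem sum_divisors_mul_of_coprime {M : Type*} [AddCommMonoid M] {a b : ℕ} (h : a.Coprime b)
    (f : ℕ → M) :
    ∑ n ∈ (a * b).divisors, f n = ∑ i ∈ a.divisors, ∑ j ∈ b.divisors, f (i * j) := by
  rw [Nat.divisors_mul, Finset.mul_def, Finset.sum_image h.mul_injOn_divisors, Finset.sum_product]

/-- A multiplicative weight that decreases along prime powers is an average of indicator functions
of sets of divisors, so positivity of all sums over divisors carries over to weighted sums. -/
theorem sum_divisors_weight_mul_nonneg (v : ℕ → ℝ) (hpos : ∀ n, 1 ≤ n → 0 < v n)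
    (hmul : ∀ m n, 1 ≤ m → 1 ≤ n → m.Coprime n → v (m * n) = v m * v n)
    (hdec : ∀ p : ℕ, p.Prime → ∀ k, v (p ^ (k + 1)) ≤ v (p ^ k)) (D : ℕ) :
    ∀ g : ℕ → ℝ, (∀ N, N ∣ D → 0 ≤ ∑ n ∈ N.divisors, g n) →
      0 ≤ ∑ n ∈ D.divisors, v n * g n := by
  induction D using Nat.recOnPosPrimePosCoprime with
  | zero => simp
  | one =>
    intro g hg
    have h1 := hg 1 dvd_rfl
    simp only [Nat.divisors_one, Finset.sum_singleton] at h1 ⊢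
    exact mul_nonneg (hpos 1 le_rfl).le h1
  | prime_pow p k hp _ =>
    intro g hg
    have key : ∀ j, j ≤ k → 0 ≤ ∑ i ∈ Finset.range (j + 1), g (p ^ i) := by
      intro j hj
      have := hg (p ^ j) (pow_dvd_pow p hj)
      rwa [Nat.sum_divisors_prime_pow hp] at this
    -- Abel summation: lowering `v (p ^ j)` to `v (p ^ (j + 1))` in front of a nonnegative partial
    -- sum only decreases it.
    have abel : ∀ j, j ≤ k → v (p ^ j) * ∑ i ∈ Finset.range (j + 1), g (p ^ i) ≤
        ∑ i ∈ Finset.range (j + 1), v (p ^ i) * g (p ^ i) := by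
      intro j
      induction j with
      | zero => simp
      | succ j ih =>
        intro hj
        rw [Finset.sum_range_succ, Finset.sum_range_succ _ (j + 1), mul_add]
        have h1 := ih (by omega)
        have h2 := mul_le_mul_of_nonneg_right (hdec p hp j) (key j (by omega))
        linarith
    rw [Nat.sum_divisors_prime_pow hp]
    exact (mul_nonneg (hpos _ (Nat.pow_pos hp.pos)).le (key k le_rfl)).trans (abel k le_rfl)
  | coprime a b ha hb hab iha ihb =>
    intro g hg
    have e : ∑ n ∈ (a * b).divisors, v n * g n =
        ∑ i ∈ a.divisors, v i * ∑ j ∈ b.divisors, v j * g (i * j) := by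
      rw [sum_divisors_mul_of_coprime hab]
      refine Finset.sum_congr rfl fun i hi => ?_
      rw [Finset.mul_sum]
      refine Finset.sum_congr rfl fun j hj => ?_
      rw [hmul i j (Nat.pos_of_mem_divisors hi) (Nat.pos_of_mem_divisors hj)
        (hab.of_dvd (Nat.dvd_of_mem_divisors hi) (Nat.dvd_of_mem_divisors hj)), mul_assoc]
    rw [e]
    -- The two weights are removed one at a time; what remains is an unweighted sum over the
    -- divisors of `A * B`, which divides `a * b`.
    refine iha _ fun A hA => ?_
    rw [Finset.sum_comm]
    simp_rw [← Finset.mul_sum]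
    refine ihb _ fun B hB => ?_
    rw [Finset.sum_comm, ← sum_divisors_mul_of_coprime (hab.of_dvd hA hB)]
    exact hg _ (mul_dvd_mul hA hB)

theorem weight_le_one (v : ℕ → ℝ) (hpos : ∀ n, 1 ≤ n → 0 < v n)
    (hmul : ∀ m n, 1 ≤ m → 1 ≤ n → m.Coprime n → v (m * n) = v m * v n)
    (hdec : ∀ p : ℕ, p.Prime → ∀ k, v (p ^ (k + 1)) ≤ v (p ^ k)) (D : ℕ) (hD : 1 ≤ D) :
    v D ≤ 1 := by
  have h1 : v 1 = 1 := by
    have h := hmul 1 1 le_rfl le_rfl (Nat.coprime_one_right 1)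
    have h' := hpos 1 le_rfl
    simp only [mul_one] at h
    nlinarith
  induction D using Nat.recOnPosPrimePosCoprime with
  | zero => omega
  | one => exact h1.le
  | prime_pow p k hp _ =>
    exact (antitone_nat_of_succ_le (f := fun k => v (p ^ k)) (hdec p hp) (Nat.zero_le k)).trans
      (by simp [h1])
  | coprime a b ha hb hab iha ihb =>
    rw [hmul a b ha.le hb.le hab]
    exact mul_le_one₀ (iha ha.le) (hpos b hb.le).le (ihb hb.le)

/-! ### Mean values on vertical lines -/

/-- `h` has mean value `l` over symmetric intervals. -/
def HasMean (h : ℝ → ℂ) (l : ℂ) : Prop :=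
  Tendsto (fun T : ℝ => (2 * T : ℂ)⁻¹ * ∫ t in -T..T, h t) atTop (𝓝 l)

theorem HasMean.const_mul {h : ℝ → ℂ} {l : ℂ} (hh : HasMean h l) (c : ℂ) :
    HasMean (fun t => c * h t) (c * l) := by
  unfold HasMean at *
  simp_rw [intervalIntegral.integral_const_mul, mul_left_comm _ c]
  exact hh.const_mul c

theorem HasMean.sum {ι : Type*} {S : Finset ι} {h : ι → ℝ → ℂ} {l : ι → ℂ}
    (hc : ∀ i ∈ S, Continuous (h i)) (hh : ∀ i ∈ S, HasMean (h i) (l i)) :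
    HasMean (fun t => ∑ i ∈ S, h i t) (∑ i ∈ S, l i) := by
  unfold HasMean at *
  have e : ∀ T : ℝ, (∫ t in -T..T, ∑ i ∈ S, h i t) = ∑ i ∈ S, ∫ t in -T..T, h i t := fun T =>
    intervalIntegral.integral_finsetSum fun i hi => (hc i hi).intervalIntegrable _ _
  simp_rw [e, Finset.mul_sum]
  exact tendsto_finsetSum _ hh

theorem HasMean.add {h k : ℝ → ℂ} {l r : ℂ} (hc : Continuous h) (kc : Continuous k)
    (hh : HasMean h l) (hk : HasMean k r) : HasMean (fun t => h t + k t) (l + r) := by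
  unfold HasMean at *
  have e : ∀ T : ℝ, (∫ t in -T..T, (h t + k t)) = (∫ t in -T..T, h t) + ∫ t in -T..T, k t :=
    fun T => intervalIntegral.integral_add (hc.intervalIntegrable _ _) (kc.intervalIntegrable _ _)
  simp_rw [e, mul_add]
  exact Tendsto.add hh hk

theorem HasMean.norm_le {h : ℝ → ℂ} {g : ℝ → ℝ} {l : ℂ} {r : ℝ} (hg : Continuous g)
    (hl : HasMean h l) (hr : HasMean (fun t => (g t : ℂ)) r) (hle : ∀ t, ‖h t‖ ≤ g t) :
    ‖l‖ ≤ r := by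
  have hr' := (Complex.continuous_re.tendsto _).comp hr
  rw [Complex.ofReal_re] at hr'
  refine le_of_tendsto_of_tendsto hl.norm hr' ?_
  filter_upwards [eventually_gt_atTop 0] with T hT
  have e : (2 * T : ℂ)⁻¹ * ∫ t in -T..T, (g t : ℂ) = (((2 * T)⁻¹ * ∫ t in -T..T, g t : ℝ) : ℂ) := by
    rw [intervalIntegral.integral_ofReal]; push_cast; rfl
  rw [Function.comp_apply, e, Complex.ofReal_re, norm_mul, norm_inv, norm_mul, Complex.norm_real,
    Real.norm_of_nonneg hT.le, Complex.norm_ofNat]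
  gcongr
  exact intervalIntegral.norm_integral_le_of_norm_le (by linarith) (.of_forall fun t _ => hle t)
    (hg.intervalIntegrable _ _)

theorem hasMean_const (c : ℂ) : HasMean (fun _ => c) c := by
  refine tendsto_const_nhds.congr' ?_
  filter_upwards [eventually_gt_atTop 0] with T hT
  have hT' : (T : ℂ) ≠ 0 := by exact_mod_cast hT.ne'
  rw [intervalIntegral.integral_const, Complex.real_smul]
  push_cast
  field_simp
  ring

theorem norm_mean_le {h : ℝ → ℂ} {C T : ℝ} (hT : 0 < T) (hh : ∀ t, ‖h t‖ ≤ C) :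
    ‖(2 * T : ℂ)⁻¹ * ∫ t in -T..T, h t‖ ≤ C := by
  have h1 := intervalIntegral.norm_integral_le_of_norm_le_const (a := -T) (b := T)
    (f := h) (C := C) fun t _ => hh t
  have h2 : ‖(2 * T : ℂ)⁻¹‖ = (2 * T)⁻¹ := by
    rw [norm_inv, norm_mul, Complex.norm_real, Real.norm_of_nonneg hT.le]; norm_num
  rw [norm_mul, h2, inv_mul_le_iff₀ (by positivity)]
  refine h1.trans (le_of_eq ?_)
  rw [abs_of_pos (by linarith)]; ring

theorem norm_exp_real_mul_I (x t : ℝ) : ‖Complex.exp (x * t * Complex.I)‖ = 1 := by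
  exact_mod_cast Complex.norm_exp_ofReal_mul_I (x * t)

theorem tendsto_const_div_two_mul_atTop (C : ℝ) : Tendsto (fun T : ℝ => C / (2 * T)) atTop (𝓝 0) :=
  tendsto_const_nhds.div_atTop (tendsto_id.const_mul_atTop two_pos)

theorem tendsto_inv_mul_of_norm_le {J : ℝ → ℂ} {C : ℝ} (hJ : ∀ T, 0 < T → ‖J T‖ ≤ C) :
    Tendsto (fun T : ℝ => (2 * T : ℂ)⁻¹ * J T) atTop (𝓝 0) := by
  refine squeeze_zero_norm' ?_ (tendsto_const_div_two_mul_atTop C)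
  filter_upwards [eventually_gt_atTop 0] with T hT
  rw [norm_mul, norm_inv, norm_mul, Complex.norm_real, Real.norm_of_nonneg hT.le,
    inv_mul_eq_div, Complex.norm_ofNat]
  gcongr
  exact hJ T hT

theorem hasMean_exp (x : ℝ) :
    HasMean (fun t => Complex.exp (x * t * Complex.I)) (if x = 0 then 1 else 0) := by
  split_ifs with hx
  · simpa [hx] using hasMean_const 1
  refine tendsto_inv_mul_of_norm_le (C := 2 / |x|) fun T _ => ?_
  have hx' : (x * Complex.I : ℂ) ≠ 0 := by simpa using hx
  have e : ∀ t : ℝ, Complex.exp (x * t * Complex.I) = Complex.exp (x * Complex.I * t) := fun t => by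
    ring_nf
  simp_rw [e]
  rw [integral_exp_mul_complex hx', norm_div]
  rw [norm_mul, Complex.norm_I, Complex.norm_real, mul_one, Real.norm_eq_abs]
  gcongr
  refine (norm_sub_le _ _).trans (le_of_eq ?_)
  rw [← e, ← e, norm_exp_real_mul_I, norm_exp_real_mul_I]
  norm_num

/-- Absolute convergence lets both the integral and the limit pass inside the sum, and only zero
frequencies survive. -/
theorem hasMean_tsum_exp {ι : Type*} [Countable ι] {d : ι → ℂ} (hd : Summable fun i => ‖d i‖)
    (x : ι → ℝ) :
    HasMean (fun t => ∑' i, d i * Complex.exp (x i * t * Complex.I))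
      (∑' i, if x i = 0 then d i else 0) := by
  have e : ∀ T : ℝ, (2 * T : ℂ)⁻¹ * ∫ t in -T..T, ∑' i, d i * Complex.exp (x i * t * Complex.I) =
      ∑' i, d i * ((2 * T : ℂ)⁻¹ * ∫ t in -T..T, Complex.exp (x i * t * Complex.I)) := by
    intro T
    rw [← (intervalIntegral.hasSum_integral_of_dominated_convergence
      (F := fun i (t : ℝ) => d i * Complex.exp (x i * t * Complex.I))
      (fun i _ => ‖d i‖) (fun i => Continuous.aestronglyMeasurable (by fun_prop))
      (fun i => ?_) ?_ intervalIntegrable_const ?_).tsum_eq, ← tsum_mul_left]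
    · refine tsum_congr fun i => ?_
      rw [intervalIntegral.integral_const_mul]
      ring
    · exact .of_forall fun _ _ => hd
    · refine .of_forall fun t _ => (Summable.of_norm ?_).hasSum
      simpa only [norm_mul, norm_exp_real_mul_I, mul_one] using hd
    · exact .of_forall fun t _ => by rw [norm_mul, norm_exp_real_mul_I, mul_one]
  unfold HasMean
  simp_rw [e]
  refine tendsto_tsum_of_dominated_convergence hd (fun i => ?_) ?_
  · have h := Tendsto.const_mul (d i) (hasMean_exp (x i))
    rwa [mul_ite, mul_one, mul_zero] at h
  · filter_upwards [eventually_gt_atTop 0] with T hT i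
    rw [norm_mul]
    exact mul_le_of_le_one_right (norm_nonneg _)
      (norm_mean_le hT fun t => (norm_exp_real_mul_I _ _).le)

/-- The mean over vertical lines of a function holomorphic and bounded on a strip does not depend on
the line. -/
theorem hasMean_shift {h : ℂ → ℂ} {a b C : ℝ} (hab : a ≤ b)
    (hd : DifferentiableOn ℂ h {s | a ≤ s.re ∧ s.re ≤ b})
    (hC : ∀ s : ℂ, a ≤ s.re → s.re ≤ b → ‖h s‖ ≤ C) {l : ℂ}
    (hl : HasMean (fun t : ℝ => h (b + t * Complex.I)) l) :
    HasMean (fun t : ℝ => h (a + t * Complex.I)) l := by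
  have key : Tendsto (fun T : ℝ => (2 * T : ℂ)⁻¹ * ((∫ t : ℝ in -T..T, h (b + t * Complex.I)) -
      ∫ t : ℝ in -T..T, h (a + t * Complex.I))) atTop (𝓝 0) := by
    -- By Cauchy's theorem the difference of the vertical sides is controlled by the two horizontal
    -- sides, each at most `C * |b - a|` whatever `T` is.
    refine tendsto_inv_mul_of_norm_le (C := C * |b - a| + C * |b - a|) fun T hT => ?_
    have rect := Complex.integral_boundary_rect_eq_zero_of_differentiableOn h
      (a + (-T : ℝ) * Complex.I) (b + (T : ℝ) * Complex.I) (hd.mono ?_)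
    · simp only [Complex.add_re, Complex.add_im, Complex.mul_re, Complex.mul_im, Complex.ofReal_re,
        Complex.ofReal_im, Complex.I_re, Complex.I_im, mul_zero, mul_one, add_zero,
        sub_zero, zero_add, smul_eq_mul] at rect
      have hor : ∀ y : ℝ, ‖∫ x : ℝ in a..b, h (x + y * Complex.I)‖ ≤ C * |b - a| := fun y => by
        refine intervalIntegral.norm_integral_le_of_norm_le_const fun x hx => ?_
        rw [Set.uIoc_of_le hab] at hx
        exact hC _ (by simpa using hx.1.le) (by simpa using hx.2)
      rw [← one_mul ‖_ - _‖, ← Complex.norm_I, ← norm_mul]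
      have e : Complex.I * ((∫ t : ℝ in -T..T, h (b + t * Complex.I)) -
          ∫ t : ℝ in -T..T, h (a + t * Complex.I)) =
          (∫ x : ℝ in a..b, h (x + T * Complex.I)) -
            ∫ x : ℝ in a..b, h (x + (-T : ℝ) * Complex.I) := by
        linear_combination rect
      rw [e]
      exact (norm_sub_le _ _).trans (add_le_add (hor _) (hor _))
    · intro s hs
      have := hs.1
      simpa [Set.uIcc_of_le hab] using this
  unfold HasMean at *
  simpa [mul_sub] using hl.sub key

/-- Parseval's identity for exponential polynomials. -/
theorem hasMean_norm_sq {ι : Type*} (S : Finset ι) (d : ι → ℂ) {x : ι → ℝ}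
    (hx : Set.InjOn x S) :
    HasMean (fun t => ((‖∑ i ∈ S, d i * Complex.exp (x i * t * Complex.I)‖ ^ 2 : ℝ) : ℂ))
      ((∑ i ∈ S, ‖d i‖ ^ 2 : ℝ) : ℂ) := by
  classical
  have e : ∀ t : ℝ, ((‖∑ i ∈ S, d i * Complex.exp (x i * t * Complex.I)‖ ^ 2 : ℝ) : ℂ) =
      ∑ i ∈ S, ∑ j ∈ S, d i * (starRingEnd ℂ) (d j) *
        Complex.exp ((x i - x j : ℝ) * t * Complex.I) := by
    intro t
    rw [Complex.ofReal_pow, ← Complex.mul_conj', map_sum, Finset.sum_mul_sum]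
    refine Finset.sum_congr rfl fun i _ => Finset.sum_congr rfl fun j _ => ?_
    rw [map_mul, ← Complex.exp_conj]
    simp only [map_mul, Complex.conj_ofReal, Complex.conj_I]
    rw [mul_mul_mul_comm, ← Complex.exp_add]
    congr 2
    push_cast; ring
  simp_rw [e]
  have : ((∑ i ∈ S, ‖d i‖ ^ 2 : ℝ) : ℂ) = ∑ i ∈ S, ∑ j ∈ S, d i * (starRingEnd ℂ) (d j) *
      if x i - x j = 0 then 1 else 0 := by
    push_cast
    refine Finset.sum_congr rfl fun i hi => ?_
    rw [Finset.sum_eq_single_of_mem i hi fun j hj hji => ?_]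
    · simp [Complex.mul_conj']
    · rw [if_neg, mul_zero]
      exact fun h => hji (hx hj hi (sub_eq_zero.1 h).symm)
  rw [this]
  exact HasMean.sum (fun i _ => by fun_prop) fun i _ => HasMean.sum (fun j _ => by fun_prop)
    fun j _ => (hasMean_exp _).const_mul _

/-! ### Norm bound for multiplication by a bounded Dirichlet series -/

theorem term_add_mul_I (c : ℕ → ℂ) (b t : ℝ) (k : ℕ) :
    LSeries.term c (b + t * Complex.I) k =
      LSeries.term c b k * Complex.exp (-(Real.log k * t * Complex.I)) := by
  rcases eq_or_ne k 0 with rfl | hk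
  · simp
  have hk' : (k : ℂ) ≠ 0 := by exact_mod_cast hk
  rw [LSeries.term_of_ne_zero hk, LSeries.term_of_ne_zero hk, Complex.cpow_add _ _ hk',
    Complex.cpow_def_of_ne_zero hk' (t * Complex.I), Complex.exp_neg, ← Complex.natCast_log,
    mul_assoc]
  field_simp

/-- The coefficients of a Dirichlet series are the means, over any vertical line in a half-plane to
which it continues as a bounded function, of its twists by imaginary powers of integers; the other
rational frequencies have mean zero. -/
theorem hasMean_coeff {δ M κ σ : ℝ} {φ : ℂ → ℂ} {c : ℕ → ℂ}
    (hφ : DifferentiableOn ℂ φ (halfPlane δ)) (hM : ∀ s ∈ halfPlane δ, ‖φ s‖ ≤ M)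
    (hc : ∀ s : ℂ, κ < s.re → LSeriesHasSum c s (φ s)) (hσ : δ < σ) {m n : ℕ} (hm : m ≠ 0)
    (hn : n ≠ 0) :
    HasMean (fun t : ℝ => φ (σ + t * Complex.I) *
      Complex.exp ((Real.log m - Real.log n) * (σ + t * Complex.I)))
      (if n ∣ m then c (m / n) else 0) := by
  set L : ℝ := Real.log m - Real.log n with hL
  rw [← Complex.ofReal_sub, ← hL]
  -- A line to the right of `σ` on which the series of `φ` converges absolutely.
  set b : ℝ := max σ κ + 1
  have hb1 : σ ≤ b := (le_max_left σ κ).trans (lt_add_one _).le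
  have hb2 : κ < b := (le_max_right σ κ).trans_lt (lt_add_one _)
  refine hasMean_shift (h := fun s => φ s * Complex.exp (L * s)) (b := b)
    (C := M * Real.exp (max (L * σ) (L * b))) hb1 ?_ ?_ ?_
  · refine DifferentiableOn.mul (hφ.mono fun s hs => hσ.trans_le hs.1) ?_
    fun_prop
  · intro s h1 h2
    rw [norm_mul, Complex.norm_exp]
    have h0 := hM s (hσ.trans_le h1)
    refine mul_le_mul h0 ?_ (Real.exp_nonneg _) ((norm_nonneg _).trans h0)
    rw [Real.exp_le_exp, Complex.re_ofReal_mul, le_max_iff]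
    rcases le_total 0 L with h | h
    · exact Or.inr (mul_le_mul_of_nonneg_left h2 h)
    · exact Or.inl (mul_le_mul_of_nonpos_left h1 h)
  · have hs : Summable fun k => ‖LSeries.term c b k * Complex.exp (L * b)‖ :=
      ((hc b (by simpa using hb2)).summable.mul_right _).norm
    convert hasMean_tsum_exp hs (fun k => L - Real.log k) using 1
    · ext t
      rw [← (hc (b + t * Complex.I) (by simpa using hb2)).tsum_eq, ← tsum_mul_right]
      refine tsum_congr fun k => ?_
      rw [term_add_mul_I, mul_assoc, mul_assoc (LSeries.term c b k), ← Complex.exp_add,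
        ← Complex.exp_add]
      congr 2
      push_cast; ring
    · have hm' : (0 : ℝ) < m := by exact_mod_cast hm.bot_lt
      have hn' : (0 : ℝ) < n := by exact_mod_cast hn.bot_lt
      have key : ∀ k : ℕ, k ≠ 0 → (L - Real.log k = 0 ↔ m = n * k) := by
        intro k hk
        have hk' : (0 : ℝ) < k := by exact_mod_cast hk.bot_lt
        rw [hL, sub_sub, ← Real.log_mul hn'.ne' hk'.ne', sub_eq_zero,
          Real.log_injOn_pos.eq_iff hm' (mul_pos hn' hk')]
        exact_mod_cast Iff.rfl
      split_ifs with hd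
      · obtain ⟨j, rfl⟩ := hd
        have hj : j ≠ 0 := right_ne_zero_of_mul hm
        have hj' : (j : ℂ) ≠ 0 := by exact_mod_cast hj
        rw [tsum_eq_single j, if_pos ((key j hj).2 rfl), Nat.mul_div_cancel_left _ hn.bot_lt,
          LSeries.term_of_ne_zero hj, Complex.cpow_def_of_ne_zero hj', ← Complex.natCast_log,
          ← sub_eq_zero.1 ((key j hj).2 rfl), div_mul_cancel₀ _ (Complex.exp_ne_zero _)]
        intro k hk
        rcases eq_or_ne k 0 with rfl | hk0
        · simp
        · rw [if_neg]
          rw [key k hk0]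
          exact fun h => hk (Nat.eq_of_mul_eq_mul_left hn.bot_lt h).symm
      · refine ((tsum_congr fun k => ?_).trans tsum_zero).symm
        rcases eq_or_ne k 0 with rfl | hk0
        · simp
        · rw [if_neg]
          rw [key k hk0]
          exact fun h => hd ⟨k, h⟩

/-- Every divisor of `m` divides `N`, so truncating `a` to the divisors of `N` does not change the
convolution at `m`. -/
theorem sum_coeff_eq_convolution (c a : ℕ → ℂ) {N m : ℕ} (hm : m ∈ N.divisors) :
    ∑ n ∈ N.divisors, (if n ∣ m then c (m / n) else 0) * a n = LSeries.convolution c a m := by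
  obtain ⟨hmN, hN⟩ := Nat.mem_divisors.1 hm
  have hm0 : m ≠ 0 := ne_zero_of_dvd_ne_zero hN hmN
  rw [LSeries.convolution_def]
  change _ = ∑ p ∈ m.divisorsAntidiagonal, c p.1 * a p.2
  rw [Nat.sum_divisorsAntidiagonal' (f := fun x y => c x * a y)]
  rw [← Finset.sum_subset (Nat.divisors_subset_of_dvd hN hmN)]
  · exact Finset.sum_congr rfl fun n hn => by rw [if_pos (Nat.dvd_of_mem_divisors hn)]
  · intro n _ hn
    rw [if_neg (fun h => hn (Nat.mem_divisors.2 ⟨h, hm0⟩)), zero_mul]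

/-- A bound for the bilinear form that a bounded Dirichlet series defines on finite sequences. -/
theorem norm_sum_convolution_le {δ M κ σ : ℝ} {φ : ℂ → ℂ} {c : ℕ → ℂ}
    (hφ : DifferentiableOn ℂ φ (halfPlane δ)) (hM : ∀ s ∈ halfPlane δ, ‖φ s‖ ≤ M)
    (hc : ∀ s : ℂ, κ < s.re → LSeriesHasSum c s (φ s)) (hσ : δ < σ) (a g : ℕ → ℂ) (N : ℕ) :
    ‖∑ m ∈ N.divisors, g m * LSeries.convolution c a m‖ ≤
      M ^ 2 / 2 * (∑ n ∈ N.divisors, ‖a n * Real.exp (-Real.log n * σ)‖ ^ 2) +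
        1 / 2 * ∑ m ∈ N.divisors, ‖g m * Real.exp (Real.log m * σ)‖ ^ 2 := by
  have hcont : Continuous fun t : ℝ => φ (σ + t * Complex.I) :=
    hφ.continuousOn.comp_continuous (by fun_prop) fun t => by simpa [halfPlane] using hσ
  have h1 : HasMean (fun t : ℝ => ∑ m ∈ N.divisors, g m * ∑ n ∈ N.divisors, a n *
      (φ (σ + t * Complex.I) *
        Complex.exp ((Real.log m - Real.log n) * (σ + t * Complex.I))))
      (∑ m ∈ N.divisors, g m * LSeries.convolution c a m) := by
    refine HasMean.sum (fun m _ => continuous_const.mul <| continuous_finsetSum _ fun n _ =>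
      continuous_const.mul (hcont.mul (by fun_prop))) fun m hm => HasMean.const_mul ?_ _
    rw [← sum_coeff_eq_convolution c a hm]
    refine HasMean.sum (fun n _ => continuous_const.mul (hcont.mul (by fun_prop)))
      fun n hn => ?_
    rw [mul_comm _ (a n)]
    exact (hasMean_coeff hφ hM hc hσ (Nat.pos_of_mem_divisors hm).ne'
      (Nat.pos_of_mem_divisors hn).ne').const_mul _
  have hinj : Set.InjOn (fun n : ℕ => Real.log n) N.divisors := by
    intro m hm n hn h
    have hm' : (0 : ℝ) < m := by exact_mod_cast Nat.pos_of_mem_divisors hm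
    have hn' : (0 : ℝ) < n := by exact_mod_cast Nat.pos_of_mem_divisors hn
    exact_mod_cast Real.log_injOn_pos hm' hn' h
  -- Since `(m/n)^s = m^s n^(-s)`, the double sum splits into `P`, carrying `n^(-s)`, and `Q`,
  -- carrying `m^s`.
  obtain ⟨P, hPdef⟩ : ∃ P : ℝ → ℂ, P = fun t : ℝ => ∑ n ∈ N.divisors,
    a n * (Real.exp (-Real.log n * σ) : ℝ) *
      Complex.exp ((-Real.log n : ℝ) * t * Complex.I) := ⟨_, rfl⟩
  obtain ⟨Q, hQdef⟩ : ∃ Q : ℝ → ℂ, Q = fun t : ℝ => ∑ n ∈ N.divisors,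
    g n * (Real.exp (Real.log n * σ) : ℝ) *
      Complex.exp (Real.log n * t * Complex.I) := ⟨_, rfl⟩
  have hPc : Continuous P := by rw [hPdef]; fun_prop
  have hQc : Continuous Q := by rw [hQdef]; fun_prop
  have hP : HasMean (fun t => ((‖P t‖ ^ 2 : ℝ) : ℂ))
      (∑ n ∈ N.divisors, ‖a n * Real.exp (-Real.log n * σ)‖ ^ 2 : ℝ) := by
    rw [hPdef]
    exact hasMean_norm_sq N.divisors (fun n => a n * Real.exp (-Real.log n * σ))
      (x := fun n : ℕ => -Real.log n) fun m hm n hn h => hinj hm hn (neg_injective h)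
  have hQ : HasMean (fun t => ((‖Q t‖ ^ 2 : ℝ) : ℂ))
      (∑ m ∈ N.divisors, ‖g m * Real.exp (Real.log m * σ)‖ ^ 2 : ℝ) := by
    rw [hQdef]
    exact hasMean_norm_sq N.divisors (fun n => g n * Real.exp (Real.log n * σ)) hinj
  have h2 := HasMean.add (by fun_prop) (by fun_prop) (hP.const_mul ((M ^ 2 / 2 : ℝ) : ℂ))
    (hQ.const_mul ((1 / 2 : ℝ) : ℂ))
  simp only [← Complex.ofReal_mul, ← Complex.ofReal_add] at h2
  refine HasMean.norm_le (by fun_prop) h1 h2 fun t => ?_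
  have e : ∑ m ∈ N.divisors, g m * ∑ n ∈ N.divisors, a n * (φ (σ + t * Complex.I) *
        Complex.exp ((Real.log m - Real.log n) * (σ + t * Complex.I))) =
      φ (σ + t * Complex.I) * P t * Q t := by
    rw [hPdef, hQdef, mul_assoc, mul_comm (∑ n ∈ _, _), Finset.sum_mul_sum, Finset.mul_sum]
    refine Finset.sum_congr rfl fun m _ => ?_
    rw [Finset.mul_sum, Finset.mul_sum]
    refine Finset.sum_congr rfl fun n _ => ?_
    have : Complex.exp ((Real.log m - Real.log n) * (σ + t * Complex.I)) =
        (Real.exp (Real.log m * σ) : ℝ) * Complex.exp (Real.log m * t * Complex.I) *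
        ((Real.exp (-Real.log n * σ) : ℝ) * Complex.exp ((-Real.log n : ℝ) * t * Complex.I)) := by
      rw [Complex.ofReal_exp, Complex.ofReal_exp, ← Complex.exp_add, ← Complex.exp_add,
        ← Complex.exp_add]
      congr 1
      push_cast; ring
    rw [this]; ring
  rw [e, norm_mul, norm_mul]
  have h3 : ‖φ (σ + t * Complex.I)‖ ≤ M := hM _ (by simpa [halfPlane] using hσ)
  have h4 : ‖φ (σ + t * Complex.I)‖ * ‖P t‖ * ‖Q t‖ ≤ M * ‖P t‖ * ‖Q t‖ := by gcongr
  -- The constants `M ^ 2 / 2` and `1 / 2` come from `M |P| |Q| ≤ (M² |P|² + |Q|²) / 2`.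
  nlinarith [sq_nonneg (M * ‖P t‖ - ‖Q t‖)]

/-- Multiplication by a bounded Dirichlet series is bounded on square summable coefficients,
in each set of divisors. -/
theorem sum_norm_sq_convolution_le {δ M κ : ℝ} {φ : ℂ → ℂ} {c : ℕ → ℂ}
    (hφ : DifferentiableOn ℂ φ (halfPlane δ)) (hM : ∀ s ∈ halfPlane δ, ‖φ s‖ ≤ M)
    (hc : ∀ s : ℂ, κ < s.re → LSeriesHasSum c s (φ s)) (a : ℕ → ℂ) (N : ℕ) :
    ∑ n ∈ N.divisors, ‖LSeries.convolution c a n‖ ^ 2 * Real.exp (-2 * δ * Real.log n) ≤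
      M ^ 2 * ∑ n ∈ N.divisors, ‖a n‖ ^ 2 * Real.exp (-2 * δ * Real.log n) := by
  set b := LSeries.convolution c a with hb
  -- With this test sequence the bilinear form and, at `σ = δ`, the last sum of the bound both equal
  -- the weighted norm of `b`; half of it is then absorbed.
  set g : ℕ → ℂ := fun m => starRingEnd ℂ (b m) * Real.exp (-2 * δ * Real.log m) with hg
  have h1 : ∀ σ ∈ Set.Ioi δ, _ := fun σ hσ => norm_sum_convolution_le hφ hM hc hσ a g N
  have hcont : Continuous fun σ : ℝ =>
      M ^ 2 / 2 * (∑ n ∈ N.divisors, ‖a n * Real.exp (-Real.log n * σ)‖ ^ 2) +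
        1 / 2 * ∑ m ∈ N.divisors, ‖g m * Real.exp (Real.log m * σ)‖ ^ 2 := by
    fun_prop
  -- `φ` is controlled only for `Re s > δ`, so the value `σ = δ` is reached as a limit from the
  -- right.
  have h2 := ge_of_tendsto ((hcont.tendsto δ).mono_left (nhdsWithin_le_nhds (s := Set.Ioi δ)))
    (eventually_mem_nhdsWithin.mono h1)
  have e1 : ∑ m ∈ N.divisors, g m * b m =
      ((∑ n ∈ N.divisors, ‖b n‖ ^ 2 * Real.exp (-2 * δ * Real.log n) : ℝ) : ℂ) := by
    push_cast
    refine Finset.sum_congr rfl fun n _ => ?_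
    rw [hg, ← Complex.conj_mul']
    push_cast; ring
  have e2 : ∀ n : ℕ, ‖a n * Real.exp (-Real.log n * δ)‖ ^ 2 =
      ‖a n‖ ^ 2 * Real.exp (-2 * δ * Real.log n) := fun n => by
    rw [norm_mul, Complex.norm_real, Real.norm_of_nonneg (Real.exp_nonneg _), mul_pow,
      ← Real.exp_nat_mul]
    congr 2; push_cast; ring
  have e3 : ∀ n : ℕ, ‖g n * Real.exp (Real.log n * δ)‖ ^ 2 =
      ‖b n‖ ^ 2 * Real.exp (-2 * δ * Real.log n) := fun n => by
    rw [hg, norm_mul, norm_mul, RCLike.norm_conj, Complex.norm_real, Complex.norm_real,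
      Real.norm_of_nonneg (Real.exp_nonneg _), Real.norm_of_nonneg (Real.exp_nonneg _), mul_assoc,
      ← Real.exp_add, mul_pow, ← Real.exp_nat_mul]
    congr 2; push_cast; ring
  simp only [e2, e3] at h2
  rw [e1, Complex.norm_real, Real.norm_of_nonneg
    (Finset.sum_nonneg fun n _ => mul_nonneg (sq_nonneg _) (Real.exp_nonneg _))] at h2
  linarith

/-! ### Convergence of Dirichlet series and the product formula -/

theorem sum_Icc_eq_sum_range_term (a : ℕ → ℂ) (s : ℂ) (N : ℕ) :
    ∑ n ∈ Finset.Icc 1 N, a n * (n : ℂ) ^ (-s) = ∑ n ∈ Finset.range (N + 1), LSeries.term a s n := by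
  induction N with
  | zero => simp
  | succ N ih =>
    rw [Finset.sum_Icc_succ_top (by omega), ih, Finset.sum_range_succ _ (N + 1),
      LSeries.term_of_ne_zero N.succ_ne_zero, Complex.cpow_neg, div_eq_mul_inv]

theorem dirichletHasSum_of_lSeriesHasSum {a : ℕ → ℂ} {s l : ℂ} (h : LSeriesHasSum a s l) :
    DirichletHasSum a s l := by
  unfold DirichletHasSum
  simp_rw [sum_Icc_eq_sum_range_term]
  exact (tendsto_add_atTop_iff_nat 1).2 h.tendsto_sum_nat

theorem DirichletHasSum.lSeriesHasSum {a : ℕ → ℂ} {s l : ℂ} (h : DirichletHasSum a s l)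
    (hs : LSeriesSummable a s) : LSeriesHasSum a s l := by
  rw [tendsto_nhds_unique h (dirichletHasSum_of_lSeriesHasSum hs.LSeriesHasSum)]
  exact hs.LSeriesHasSum

/-- A Dirichlet series that converges at a point converges absolutely one unit to the right. -/
theorem DirichletHasSum.lSeriesSummable {a : ℕ → ℂ} {s₀ l s : ℂ} (h : DirichletHasSum a s₀ l)
    (hs : s₀.re + 1 < s.re) : LSeriesSummable a s := by
  unfold DirichletHasSum at h
  simp_rw [sum_Icc_eq_sum_range_term] at h
  have h0 : Tendsto (fun N => LSeries.term a s₀ (N + 1)) atTop (𝓝 0) := by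
    have := ((tendsto_add_atTop_iff_nat 1).2 h).sub h
    simpa [Finset.sum_range_succ _ (_ + 1)] using this
  obtain ⟨B, hB⟩ := h0.norm.bddAbove_range
  refine LSeriesSummable_of_le_const_mul_rpow hs ⟨B, fun n hn => ?_⟩
  obtain ⟨k, rfl⟩ := Nat.exists_eq_succ_of_ne_zero hn
  have h1 : ‖LSeries.term a s₀ (k + 1)‖ ≤ B := hB ⟨k, rfl⟩
  rw [LSeries.norm_term_eq, if_neg hn, div_le_iff₀ (by positivity)] at h1
  simpa only [add_sub_cancel_right] using h1

theorem IsDirichletRepresentable.exists_lSeriesHasSum {U : Set ℂ} {φ : ℂ → ℂ}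
    (h : IsDirichletRepresentable U φ) :
    ∃ (κ : ℝ) (c : ℕ → ℂ), ∀ s : ℂ, κ < s.re → LSeriesHasSum c s (φ s) := by
  obtain ⟨r, _, c, hc⟩ := h
  -- Convergence at `r + 1` gives absolute convergence to the right of `r + 2`.
  refine ⟨r + 2, c, fun s hs => (hc s ?_).lSeriesHasSum
    ((hc (r + 1 : ℝ) ?_).lSeriesSummable ?_)⟩
  · simp only [halfPlane, Set.mem_ofPred_eq]; linarith
  · simp [halfPlane]
  · rw [Complex.ofReal_re]; linarith

/-- Cauchy–Schwarz in termwise form: `|a| n^(-σ) ≤ |a|² w + w⁻¹ n^(-2σ)`. -/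
theorem lSeriesSummable_of_weighted {w : ℕ → ℝ} {a : ℕ → ℂ} {s : ℂ}
    (hpos : ∀ n : ℕ, 1 ≤ n → 0 < w n)
    (hsum : Summable (fun n : ℕ => (w (n + 1))⁻¹ * ((n + 1 : ℕ) : ℝ) ^ (-2 * s.re)))
    (ha : Summable (fun n : ℕ => ‖a (n + 1)‖ ^ 2 * w (n + 1))) : LSeriesSummable a s := by
  refine (summable_nat_add_iff 1).1 (Summable.of_norm_bounded (ha.add hsum) fun n => ?_)
  have hn : (0 : ℝ) < (n + 1 : ℕ) := by positivity
  have hw := hpos (n + 1) (by omega)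
  rw [LSeries.norm_term_eq, if_neg n.succ_ne_zero, div_eq_mul_inv, ← Real.rpow_neg hn.le]
  have e : ((n + 1 : ℕ) : ℝ) ^ (-2 * s.re) = (((n + 1 : ℕ) : ℝ) ^ (-s.re)) ^ 2 := by
    rw [← Real.rpow_mul_natCast hn.le]; congr 1; push_cast; ring
  rw [e]
  set x := ‖a (n + 1)‖
  set y := ((n + 1 : ℕ) : ℝ) ^ (-s.re)
  have hv : w (n + 1) * (w (n + 1))⁻¹ = 1 := mul_inv_cancel₀ hw.ne'
  have hx : 0 ≤ x := norm_nonneg _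
  have hy : 0 ≤ y := by positivity
  have h1 : 0 ≤ (w (n + 1))⁻¹ * (w (n + 1) * x - y) ^ 2 := by positivity
  have h2 : (w (n + 1))⁻¹ * (w (n + 1) * x - y) ^ 2 =
      x ^ 2 * w (n + 1) + (w (n + 1))⁻¹ * y ^ 2 - 2 * (x * y) := by
    linear_combination (x ^ 2 * w (n + 1) - 2 * x * y) * hv
  nlinarith [mul_nonneg hx hy]

theorem isOpen_halfPlane (δ : ℝ) : IsOpen (halfPlane δ) :=
  isOpen_lt continuous_const Complex.continuous_re

theorem isPreconnected_halfPlane (δ : ℝ) : IsPreconnected (halfPlane δ) :=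
  (convex_halfSpace_re_gt δ).isPreconnected

theorem lSeries_analyticOnNhd_halfPlane {a : ℕ → ℂ} {σ₀ : ℝ}
    (h : ∀ s ∈ halfPlane σ₀, LSeriesSummable a s) : AnalyticOnNhd ℂ (LSeries a) (halfPlane σ₀) := by
  refine (LSeries_analyticOnNhd a).mono fun s hs => ?_
  refine lt_of_le_of_lt
    (LSeries.abscissaOfAbsConv_le_of_forall_lt_LSeriesSummable (x := σ₀) fun y hy => h y ?_) ?_
  · simpa [halfPlane] using hy
  · exact EReal.coe_lt_coe_iff.2 hs

/-- Far to the right all three series converge absolutely and multiply; both sides are analytic on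
the connected half-plane, so the identity theorem extends the equality. -/
theorem lSeries_eq_mul {φ : ℂ → ℂ} {a c : ℕ → ℂ} {κ σ₀ : ℝ}
    (hφ : DifferentiableOn ℂ φ (halfPlane σ₀))
    (hc : ∀ s : ℂ, κ < s.re → LSeriesHasSum c s (φ s))
    (ha : ∀ s ∈ halfPlane σ₀, LSeriesSummable a s)
    (hb : ∀ s ∈ halfPlane σ₀, LSeriesSummable (LSeries.convolution c a) s) :
    Set.EqOn (LSeries (LSeries.convolution c a)) (fun s => φ s * LSeries a s) (halfPlane σ₀) := by
  have hmem : ∀ s ∈ halfPlane (max κ σ₀), κ < s.re ∧ s ∈ halfPlane σ₀ := fun s hs =>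
    ⟨(le_max_left _ _).trans_lt hs, (le_max_right κ σ₀).trans_lt hs⟩
  have h0 : ((max κ σ₀ + 1 : ℝ) : ℂ) ∈ halfPlane (max κ σ₀) :=
    lt_add_one (max κ σ₀)
  refine (lSeries_analyticOnNhd_halfPlane hb).eqOn_of_preconnected_of_eventuallyEq
    ((hφ.analyticOnNhd (isOpen_halfPlane _)).mul (lSeries_analyticOnNhd_halfPlane ha))
    (isPreconnected_halfPlane _) (hmem _ h0).2 ?_
  filter_upwards [(isOpen_halfPlane _).mem_nhds h0] with s hs
  obtain ⟨h1, h2⟩ := hmem s hs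
  rw [LSeries_convolution' (hc s h1).LSeriesSummable (ha s h2), (hc s h1).LSeries_eq]

/-! ### The shifted weight and the multiplier theorem -/

/-- The weight `w n * n ^ (2 * δ)` is multiplicative if `w` is. -/
theorem shifted_weight_mul {w : ℕ → ℝ} {δ : ℝ}
    (hmul : ∀ m n : ℕ, 1 ≤ m → 1 ≤ n → Nat.Coprime m n → w (m * n) = w m * w n) (m n : ℕ)
    (hm : 1 ≤ m) (hn : 1 ≤ n) (h : m.Coprime n) :
    w (m * n) * Real.exp (2 * δ * Real.log (m * n : ℕ)) =
      w m * Real.exp (2 * δ * Real.log m) * (w n * Real.exp (2 * δ * Real.log n)) := by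
  have hm' : (m : ℝ) ≠ 0 := by exact_mod_cast (by omega : m ≠ 0)
  have hn' : (n : ℝ) ≠ 0 := by exact_mod_cast (by omega : n ≠ 0)
  rw [hmul m n hm hn h, Nat.cast_mul, Real.log_mul hm' hn', mul_add, Real.exp_add]
  ring

theorem shifted_weight_succ_le {w : ℕ → ℝ} {δ : ℝ}
    (hdec : ∀ p : ℕ, p.Prime → ∀ k : ℕ, 1 ≤ k →
      w (p ^ k) ≤ (p : ℝ) ^ (-2 * δ) * w (p ^ (k - 1))) (p : ℕ) (hp : p.Prime) (k : ℕ) :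
    w (p ^ (k + 1)) * Real.exp (2 * δ * Real.log (p ^ (k + 1) : ℕ)) ≤
      w (p ^ k) * Real.exp (2 * δ * Real.log (p ^ k : ℕ)) := by
  have hp' : (0 : ℝ) < p := by exact_mod_cast hp.pos
  have h := mul_le_mul_of_nonneg_right (hdec p hp (k + 1) (by omega))
    (Real.exp_nonneg (2 * δ * Real.log (p ^ (k + 1) : ℕ)))
  refine h.trans (le_of_eq ?_)
  rw [Real.rpow_def_of_pos hp', mul_comm (Real.exp _), mul_assoc, ← Real.exp_add,
    Nat.add_sub_cancel]
  congr 2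
  push_cast
  rw [Real.log_pow, Real.log_pow]
  push_cast; ring

end DirichletMult

theorem mainTheorem5 (w : ℕ → ℝ) (δ σ₀ : ℝ)
    (hpos : ∀ n : ℕ, 1 ≤ n → 0 < w n)
    (hsum : ∀ σ : ℝ, σ₀ < σ →
      Summable (fun n : ℕ => (w (n + 1))⁻¹ * ((n + 1 : ℕ) : ℝ) ^ (-2 * σ)))
    (hδ : 0 ≤ δ)
    (hmul : ∀ m n : ℕ, 1 ≤ m → 1 ≤ n → Nat.Coprime m n → w (m * n) = w m * w n)
    (hdec : ∀ p : ℕ, p.Prime → ∀ k : ℕ, 1 ≤ k →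
      w (p ^ k) ≤ (p : ℝ) ^ (-2 * δ) * w (p ^ (k - 1)))
    (φ : ℂ → ℂ)
    (hφ : DirichletMult.IsHInfty (DirichletMult.halfPlane δ) φ)
    (hφD : DirichletMult.IsDirichletRepresentable (DirichletMult.halfPlane δ) φ) :
    DirichletMult.IsMultiplier w σ₀ (DirichletMult.halfPlane δ) φ := by
  have vpos : ∀ n, 1 ≤ n → 0 < w n * Real.exp (2 * δ * Real.log n) := fun n hn =>
    mul_pos (hpos n hn) (Real.exp_pos _)
  have vmul := DirichletMult.shifted_weight_mul (δ := δ) hmul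
  have vdec := DirichletMult.shifted_weight_succ_le hdec
  have hsub : DirichletMult.halfPlane σ₀ ⊆ DirichletMult.halfPlane δ := by
    intro s hs
    -- From `v n ≤ 1` follows `n^(2δ) ≤ (w n)⁻¹`, so this series converges; its exponent must then
    -- be below `-1`, which forces `Re s > δ`.
    have h1 : Summable fun n : ℕ => ((n + 1 : ℕ) : ℝ) ^ (2 * δ - 2 * s.re) := by
      refine Summable.of_nonneg_of_le (fun n => by positivity) (fun n => ?_) (hsum s.re hs)
      have hn : (0 : ℝ) < (n + 1 : ℕ) := by positivity
      have h := DirichletMult.weight_le_one _ vpos vmul vdec (n + 1) (by omega)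
      rw [sub_eq_add_neg, Real.rpow_add hn, ← neg_mul]
      refine mul_le_mul_of_nonneg_right ?_ (by positivity)
      rw [Real.rpow_def_of_pos hn, mul_comm (Real.log _), ← one_div,
        le_div_iff₀ (hpos _ (by omega)), mul_comm]
      exact h
    have h2 := Real.summable_nat_rpow.1
      ((summable_nat_add_iff (f := fun n : ℕ => (n : ℝ) ^ (2 * δ - 2 * s.re)) 1).1 h1)
    simp only [DirichletMult.halfPlane, Set.mem_ofPred_eq]
    linarith
  obtain ⟨hd, M, hM⟩ := hφ
  obtain ⟨κ, c, hc⟩ := hφD.exists_lSeriesHasSum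
  refine ⟨hsub, ?_⟩
  rintro f ⟨a, ha, hf⟩
  have hb : Summable fun n : ℕ => ‖LSeries.convolution c a (n + 1)‖ ^ 2 * w (n + 1) := by
    have hnn : ∀ n : ℕ, 0 ≤ ‖a (n + 1)‖ ^ 2 * w (n + 1) := fun n =>
      mul_nonneg (sq_nonneg _) (hpos _ (by omega)).le
    refine summable_of_sum_le (c := M ^ 2 * ∑' n : ℕ, ‖a (n + 1)‖ ^ 2 * w (n + 1))
      (fun n => mul_nonneg (sq_nonneg _) (hpos _ (by omega)).le) fun u => ?_
    -- A common multiple of the indices `n + 1` with `n ∈ u`: the sum over `u` is part of the sum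
    -- over the divisors of `D`.
    set D : ℕ := ∏ n ∈ u, (n + 1) with hD
    have hD0 : D ≠ 0 := Finset.prod_ne_zero_iff.2 fun n _ => n.succ_ne_zero
    have key := DirichletMult.sum_divisors_weight_mul_nonneg _ vpos vmul vdec D
      (fun n => (M ^ 2 * ‖a n‖ ^ 2 - ‖LSeries.convolution c a n‖ ^ 2) *
        Real.exp (-2 * δ * Real.log n)) fun N _ => by
          have := DirichletMult.sum_norm_sq_convolution_le hd hM hc a N
          rw [Finset.mul_sum, ← sub_nonneg, ← Finset.sum_sub_distrib] at this
          refine this.trans (le_of_eq (Finset.sum_congr rfl fun n _ => by ring))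
    have e : ∀ n : ℕ, w n * Real.exp (2 * δ * Real.log n) *
        ((M ^ 2 * ‖a n‖ ^ 2 - ‖LSeries.convolution c a n‖ ^ 2) *
          Real.exp (-2 * δ * Real.log n)) =
        M ^ 2 * (‖a n‖ ^ 2 * w n) - ‖LSeries.convolution c a n‖ ^ 2 * w n := fun n => by
      have : Real.exp (2 * δ * Real.log n) * Real.exp (-2 * δ * Real.log n) = 1 := by
        rw [← Real.exp_add, ← Real.exp_zero]; congr 1; ring
      linear_combination w n * (M ^ 2 * ‖a n‖ ^ 2 - ‖LSeries.convolution c a n‖ ^ 2) * this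
    simp only [e] at key
    rw [Finset.sum_sub_distrib, ← Finset.mul_sum, sub_nonneg] at key
    have himg : ∀ F : ℕ → ℝ, ∑ n ∈ D.divisors, F n =
        ∑ n ∈ D.divisors.image Nat.pred, F (n + 1) := fun F => by
      rw [Finset.sum_image]
      · exact Finset.sum_congr rfl fun n hn => by
          rw [Nat.pred_eq_sub_one, Nat.sub_add_cancel (Nat.pos_of_mem_divisors hn)]
      · intro m hm n hn h
        exact Nat.pred_inj (Nat.pos_of_mem_divisors hm) (Nat.pos_of_mem_divisors hn) h
    rw [himg, himg] at key
    refine (Finset.sum_le_sum_of_subset_of_nonneg ?_ fun n _ _ =>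
      mul_nonneg (sq_nonneg _) (hpos _ (by omega)).le).trans (key.trans ?_)
    · intro n hn
      exact Finset.mem_image.2 ⟨n + 1, Nat.mem_divisors.2 ⟨Finset.dvd_prod_of_mem _ hn, hD0⟩, rfl⟩
    · exact mul_le_mul_of_nonneg_left (ha.sum_le_tsum _ fun n _ => hnn n) (sq_nonneg M)
  have hA : ∀ s ∈ DirichletMult.halfPlane σ₀, LSeriesSummable a s := fun s hs =>
    DirichletMult.lSeriesSummable_of_weighted hpos (hsum _ hs) ha
  have hB : ∀ s ∈ DirichletMult.halfPlane σ₀, LSeriesSummable (LSeries.convolution c a) s :=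
    fun s hs => DirichletMult.lSeriesSummable_of_weighted hpos (hsum _ hs) hb
  refine ⟨LSeries.convolution c a, hb, fun s => ?_⟩
  refine DirichletMult.dirichletHasSum_of_lSeriesHasSum ?_
  have h := DirichletMult.lSeries_eq_mul (hd.mono hsub) hc hA hB s.2
  simp only [((hf s).lSeriesHasSum (hA s s.2)).LSeries_eq] at h
  change LSeriesHasSum _ _ (φ s * f s)
  rw [← h]
  exact (hB s s.2).LSeriesHasSum
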